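/- Let $(Y,X^{(1)},\dots,X^{(p)})$ be a random vector in $\mathbb R^{p+1}$ whose coordinates are square integrable, with $\mathrm{Var}(Y)>0$. Assume that $\mathbf 1,X^{(1)},\dots,X^{(p)}$ are linearly independent, i.e. no nonzero $\gamma\in\mathbb R^{p+1}$ satisfies $\gamma_0+\gamma_1X^{(1)}+\dots+\gamma_pX^{(p)}=0$ almost surely. Let $V$ be the linear subspace of $\mathbb L^2$ generated by $\mathbf 1,X^{(1)},\dots,X^{(p)}$ and $W$ the one generated by $\mathbf 1,Y$; let $\mathrm{Proj}_V$ and $\mathrm{Proj}_W$ be the orthogonal projections, write $\mathrm{Proj}_V(Y)=\alpha_0+\alpha_1X^{(1)}+\dots+\alpha_pX^{(p)}$, and set $$\varepsilon=Y-\mathrm{Proj}_V(Y),\qquad e^{(k)}=X^{(k)}-\mathrm{Proj}_W(X^{(k)}),\qquad \theta_k=\frac{\mathrm{Cov}(Y,X^{(k)})}{\mathrm{Var}(Y)}\quad(1\le k\le p).$$ Put $\alpha=(\alpha_1,\dots,\alpha_p)^t$ and $\theta=(\theta_1,\dots,\theta_p)^t$. Assume moreover that for all $j\in\{1,\dots,p\}$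 $$\mathbb E\big((X^{(j)}-\mathbb E X^{(j)})^2\varepsilon^2\big)<\infty\quad\text{and}\quad \mathbb E\big((Y-\mathbb E Y)^2(e^{(j)})^2\big)<\infty .$$ Let $(Y_i,X_i^{(1)},\dots,X_i^{(p)})_{i\ge1}$ be independent copies of $(Y,X^{(1)},\dots,X^{(p)})$. For each $n$, let $\mathbf Y=(Y_1,\dots,Y_n)^t$, let $\mathbf X$ be the $n\times(p+1)$ matrix with $i$-th row $(1,X_i^{(1)},\dots,X_i^{(p)})$, let $(\hat\alpha_0,\dots,\hat\alpha_p)^t=(\mathbf X^t\mathbf X)^{-1}\mathbf X^t\mathbf Y$, $\hat\alpha=(\hat\alpha_1,\dots,\hat\alpha_p)^t$, and let $\hat\theta=(\hat\theta_1,\dots,\hat\theta_p)^t$ with $$\hat\theta_k=\frac{\sum_{i=1}^n(Y_i-\overline{\mathbf Y})(X_i^{(k)}-\overline{\mathbf X}^{(k)})}{\sum_{i=1}^n(Y_i-\overline{\mathbf Y})^2},$$ where bars denote empirical means over $i=1,\dots,n$; $(\hat\alpha_0,\dots,\hat\alpha_p)$ is set to $0$ when $\mathbf X^t\mathbf X$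 is singular, and $\hat\theta_k$ is set to $0$ when its denominator vanishes. Let $\mathbf A$ be the symmetric $2p\times2p$ matrix with, for $j,k\in\{1,\dots,p\}$, $$\mathbf A_{j,k}=\mathbb E\big((X^{(j)}-\mathbb EX^{(j)})(X^{(k)}-\mathbb EX^{(k)})\varepsilon^2\big),\quad \mathbf A_{p+j,p+k}=\mathbb E\big((Y-\mathbb EY)^2e^{(j)}e^{(k)}\big),$$ $$\mathbf A_{j,p+k}=\mathbf A_{p+k,j}=\mathbb E\big((X^{(j)}-\mathbb EX^{(j)})(Y-\mathbb EY)\,\varepsilon\, e^{(k)}\big),$$ and let $\mathbf B$ be the block-diagonal $2p\times2p$ matrix with diagonal blocks $\mathbf M_0^{-1}$ and $\mathrm{Var}(Y)^{-1}I_p$, where $(\mathbf M_0)_{j,k}=\mathrm{Cov}(X^{(j)},X^{(k)})$. Then $\mathbf B\mathbf A\mathbf B$ is positive semidefinite and, as $n\to\infty$, $$\sqrt n\,\big([\hat\alpha:\hat\theta]-[\alpha:\theta]\big)\ \xrightarrow{\ \mathcal L\ }\ \mathcal N_{2p}(0,\mathbf B\mathbf A\mathbf B),$$ where $[a:b]\in\mathbb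 R^{2p}$ denotes the vector $a$ followed by the vector $b$. -/

import Mathlib

open MeasureTheory ProbabilityTheory Filter

namespace MultipleRegression

noncomputable section

/-! ### Population quantities: projections in `L²`, regression coefficients, residuals -/

/-- The family `1, Z⁽¹⁾, …, Z⁽ᵏ⁾` obtained from `Z⁽¹⁾, …, Z⁽ᵏ⁾` by adding the constant random
variable `1` as the member of index `0`. -/
def withConst {Ω : Type*} {k : ℕ} (Z : Fin k → Ω → ℝ) : Fin (k + 1) → Ω → ℝ :=
  Fin.cons (fun _ => 1) Z

theorem memLp_withConst {Ω : Type*} [MeasurableSpace Ω] {μ : Measure Ω} [IsFiniteMeasure μ]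
    {k : ℕ} {Z : Fin k → Ω → ℝ} (hZ : ∀ j, MemLp (Z j) 2 μ) (j : Fin (k + 1)) :
    MemLp (withConst Z j) 2 μ := by
  refine Fin.cases ?_ (fun i => ?_) j
  · exact memLp_const 1
  · exact hZ i

/-- `1, Z⁽¹⁾, …, Z⁽ᵏ⁾` are linearly independent as random variables: no nontrivial linear
combination of them vanishes almost surely. -/
def LinIndepWithConst {Ω : Type*} [MeasurableSpace Ω] (μ : Measure Ω) {k : ℕ}
    (Z : Fin k → Ω → ℝ) : Prop :=
  ∀ γ : Fin (k + 1) → ℝ, (∀ᵐ ω ∂μ, ∑ j, γ j * withConst Z j ω = 0) → γ = 0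

/-- The linear subspace of `L²(μ)` generated by `1, Z⁽¹⁾, …, Z⁽ᵏ⁾`. -/
def affSpan {Ω : Type*} [MeasurableSpace Ω] {μ : Measure Ω} [IsFiniteMeasure μ] {k : ℕ}
    {Z : Fin k → Ω → ℝ} (hZ : ∀ j, MemLp (Z j) 2 μ) : Submodule ℝ (Lp ℝ 2 μ) :=
  Submodule.span ℝ (Set.range fun j => (memLp_withConst hZ j).toLp (withConst Z j))

instance {Ω : Type*} [MeasurableSpace Ω] {μ : Measure Ω} [IsFiniteMeasure μ] {k : ℕ}
    {Z : Fin k → Ω → ℝ} (hZ : ∀ j, MemLp (Z j) 2 μ) : FiniteDimensional ℝ (affSpan hZ) :=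
  FiniteDimensional.span_of_finite ℝ (Set.finite_range _)

/-- (A representative of) the orthogonal projection in `L²(μ)` of the random variable `T` onto the
subspace generated by `1, Z⁽¹⁾, …, Z⁽ᵏ⁾`. -/
def proj {Ω : Type*} [MeasurableSpace Ω] {μ : Measure Ω} [IsFiniteMeasure μ] {k : ℕ}
    {Z : Fin k → Ω → ℝ} (hZ : ∀ j, MemLp (Z j) 2 μ) {T : Ω → ℝ} (hT : MemLp T 2 μ) : Ω → ℝ :=
  ((affSpan hZ).starProjection (hT.toLp T) : Lp ℝ 2 μ)

/-- The residual `T - Proj(T)` of the projection of `T` onto the span of `1, Z⁽¹⁾, …, Z⁽ᵏ⁾`. -/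
def resid {Ω : Type*} [MeasurableSpace Ω] {μ : Measure Ω} [IsFiniteMeasure μ] {k : ℕ}
    {Z : Fin k → Ω → ℝ} (hZ : ∀ j, MemLp (Z j) 2 μ) {T : Ω → ℝ} (hT : MemLp T 2 μ) : Ω → ℝ :=
  fun ω => T ω - proj hZ hT ω

theorem exists_coeff {Ω : Type*} [MeasurableSpace Ω] {μ : Measure Ω} [IsFiniteMeasure μ] {k : ℕ}
    {Z : Fin k → Ω → ℝ} (hZ : ∀ j, MemLp (Z j) 2 μ) {T : Ω → ℝ} (hT : MemLp T 2 μ) :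
    ∃ a : Fin (k + 1) → ℝ, proj hZ hT =ᵐ[μ] fun ω => ∑ j, a j * withConst Z j ω := by
  obtain ⟨a, ha⟩ := (Submodule.mem_span_range_iff_exists_fun ℝ).1
    ((affSpan hZ).starProjection_apply_mem (hT.toLp T))
  refine ⟨a, ?_⟩
  unfold proj
  rw [← ha]
  refine (Lp.coeFn_finsetSum _ _).trans ?_
  have h1 : ∀ᵐ ω ∂μ, ∀ j : Fin (k + 1),
      (a j • (memLp_withConst hZ j).toLp (withConst Z j) : Lp ℝ 2 μ) ω
        = a j * withConst Z j ω := by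
    rw [ae_all_iff]
    intro j
    filter_upwards [Lp.coeFn_smul (a j) ((memLp_withConst hZ j).toLp (withConst Z j)),
      (memLp_withConst hZ j).coeFn_toLp] with ω h2 h3
    rw [h2, Pi.smul_apply, h3, smul_eq_mul]
  filter_upwards [h1] with ω hω
  simp [Finset.sum_apply, hω]

/-- The coefficients `(a₀, a₁, …, a_k)` of the projection of `T` onto the span of
`1, Z⁽¹⁾, …, Z⁽ᵏ⁾`, i.e. `Proj(T) = a₀ + a₁ Z⁽¹⁾ + ⋯ + a_k Z⁽ᵏ⁾` almost surely. They are unique as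
soon as `1, Z⁽¹⁾, …, Z⁽ᵏ⁾` are linearly independent. -/
def coeff {Ω : Type*} [MeasurableSpace Ω] {μ : Measure Ω} [IsFiniteMeasure μ] {k : ℕ}
    {Z : Fin k → Ω → ℝ} (hZ : ∀ j, MemLp (Z j) 2 μ) {T : Ω → ℝ} (hT : MemLp T 2 μ) :
    Fin (k + 1) → ℝ :=
  Classical.choose (exists_coeff hZ hT)

/-- The regression slopes `α = (α₁, …, α_p)` of `Y` on `X⁽¹⁾, …, X⁽ᵖ⁾` (without intercept). -/
def alpha {Ω : Type*} [MeasurableSpace Ω] {μ : Measure Ω} [IsFiniteMeasure μ] {p : ℕ}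
    {Y : Ω → ℝ} {X : Fin p → Ω → ℝ} (hY : MemLp Y 2 μ) (hX : ∀ j, MemLp (X j) 2 μ) :
    Fin p → ℝ :=
  fun j => coeff hX hY j.succ

/-- `θ_k = Cov(Y, X⁽ᵏ⁾) / Var(Y)`. -/
def theta {Ω : Type*} [MeasurableSpace Ω] (μ : Measure Ω) {p : ℕ}
    (Y : Ω → ℝ) (X : Fin p → Ω → ℝ) : Fin p → ℝ :=
  fun k => cov[Y, X k; μ] / Var[Y; μ]

/-- `ε = Y - Proj_V(Y)`, where `V` is generated by `1, X⁽¹⁾, …, X⁽ᵖ⁾`. -/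
def eps {Ω : Type*} [MeasurableSpace Ω] {μ : Measure Ω} [IsFiniteMeasure μ] {p : ℕ}
    {Y : Ω → ℝ} {X : Fin p → Ω → ℝ} (hY : MemLp Y 2 μ) (hX : ∀ j, MemLp (X j) 2 μ) : Ω → ℝ :=
  resid hX hY

/-- `e⁽ᵏ⁾ = X⁽ᵏ⁾ - Proj_W(X⁽ᵏ⁾)`, where `W` is generated by `1, Y`. -/
def eres {Ω : Type*} [MeasurableSpace Ω] {μ : Measure Ω} [IsFiniteMeasure μ] {p : ℕ}
    {Y : Ω → ℝ} {X : Fin p → Ω → ℝ} (hY : MemLp Y 2 μ) (hX : ∀ j, MemLp (X j) 2 μ)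
    (k : Fin p) : Ω → ℝ :=
  resid (Z := fun _ : Fin 1 => Y) (fun _ => hY) (hX k)

/-! ### The two matrices of the limit law

Coordinates `1, …, 2p` are indexed by `Fin p ⊕ Fin p`, the left summand being `1, …, p`. -/

/-- The covariance matrix of `(X⁽¹⁾, …, X⁽ᵖ⁾)`. -/
def covMatrix {Ω : Type*} [MeasurableSpace Ω] (μ : Measure Ω) {p : ℕ}
    (X : Fin p → Ω → ℝ) : Matrix (Fin p) (Fin p) ℝ :=
  Matrix.of fun j l => cov[X j, X l; μ]

/-- The symmetric matrix `A` of the moments of `(X⁽ʲ⁾ - E X⁽ʲ⁾) ε` and `(Y - E Y) e⁽ᵏ⁾`. -/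
def matA {Ω : Type*} [MeasurableSpace Ω] {μ : Measure Ω} [IsFiniteMeasure μ] {p : ℕ}
    {Y : Ω → ℝ} {X : Fin p → Ω → ℝ} (hY : MemLp Y 2 μ) (hX : ∀ j, MemLp (X j) 2 μ) :
    Matrix (Fin p ⊕ Fin p) (Fin p ⊕ Fin p) ℝ :=
  let A12 : Matrix (Fin p) (Fin p) ℝ := Matrix.of fun j k =>
    ∫ ω, (X j ω - μ[X j]) * (Y ω - μ[Y]) * eps hY hX ω * eres hY hX k ω ∂μ
  Matrix.fromBlocks
    (Matrix.of fun j k => ∫ ω, (X j ω - μ[X j]) * (X k ω - μ[X k]) * eps hY hX ω ^ 2 ∂μ)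
    A12 A12.transpose
    (Matrix.of fun j k => ∫ ω, (Y ω - μ[Y]) ^ 2 * eres hY hX j ω * eres hY hX k ω ∂μ)

/-- The block-diagonal matrix `B` with blocks `M₀⁻¹` (inverse covariance matrix of the `X⁽ʲ⁾`) and
`Var(Y)⁻¹ I_p`. -/
def matB {Ω : Type*} [MeasurableSpace Ω] (μ : Measure Ω) {p : ℕ}
    (Y : Ω → ℝ) (X : Fin p → Ω → ℝ) : Matrix (Fin p ⊕ Fin p) (Fin p ⊕ Fin p) ℝ :=
  Matrix.fromBlocks (covMatrix μ X)⁻¹ 0 0 (Var[Y; μ]⁻¹ • 1)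

/-! ### Empirical quantities, as functions of the data `(yᵢ, xᵢ)`, `i = 1, …, n` -/

/-- The `n × (p+1)` design matrix, whose column of index `0` is constant equal to `1`. -/
def design {n p : ℕ} (x : Fin n → Fin p → ℝ) : Matrix (Fin n) (Fin (p + 1)) ℝ :=
  Matrix.of fun i => Fin.cons 1 (x i)

/-- The least squares estimator `(𝐗ᵗ𝐗)⁻¹ 𝐗ᵗ 𝐘` of the regression coefficients, intercept included
(it is set to `0` when `𝐗ᵗ𝐗` is singular). -/
def olsCoeff {n p : ℕ} (y : Fin n → ℝ) (x : Fin n → Fin p → ℝ) : Fin (p + 1) → ℝ :=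
  ((design x).transpose * design x)⁻¹.mulVec ((design x).transpose.mulVec y)

/-- The estimated slopes `α̂ = (α̂₁, …, α̂_p)`. -/
def alphaHat {n p : ℕ} (y : Fin n → ℝ) (x : Fin n → Fin p → ℝ) : Fin p → ℝ :=
  fun j => olsCoeff y x j.succ

/-- The empirical mean of `z₁, …, z_n`. -/
def mean {n : ℕ} (z : Fin n → ℝ) : ℝ := (∑ i, z i) / n

/-- `θ̂_k = ∑ (yᵢ - ȳ) (xᵢ⁽ᵏ⁾ - x̄⁽ᵏ⁾) / ∑ (yᵢ - ȳ)²` (set to `0` when the denominator is `0`). -/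
def thetaHat {n p : ℕ} (y : Fin n → ℝ) (x : Fin n → Fin p → ℝ) : Fin p → ℝ :=
  fun k => (∑ i, (y i - mean y) * (x i k - mean fun l => x l k)) / ∑ i, (y i - mean y) ^ 2

/-- The stacked vector `[a : b]` of `ℝ^{2p}`. -/
def stack {p : ℕ} (a b : Fin p → ℝ) : EuclideanSpace ℝ (Fin p ⊕ Fin p) :=
  WithLp.toLp 2 (Sum.elim a b)

end

end MultipleRegression

open MultipleRegression

namespace MultipleRegression

open scoped Topology

/-! The errors of both estimators are given by exact identities, not expansions. An empirical
covariance is unchanged when its arguments are translated, so the regressors may be centred at the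
population means, and the intercepts of the population projections drop out. Hence √n times the
stacked error equals `empB` applied to Z₁ - D Z₂: Z₁ is the normalised sum of the products (centred
regressor) × (residual), Z₂ that of the residuals alone, and D is the diagonal matrix of the
empirical means of the centred regressors (`alphaHat_sub`, `thetaHat_sub`, `stack_hat_sub`).

Orthogonality in L² centres the residuals and these products, and the moment assumptions make the
products square integrable; so (Z₁, Z₂) satisfies a joint central limit theorem, with covariance S.
By the strong law `empB` tends to B and D to 0 almost surely (`tendsto_empB_ae`), so the random
matrix [`empB` | -`empB` D] tends to [B | 0]. Slutsky's theorem (`tendstoInDistribution_mulVec`)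
yields a Gaussian limit with covariance [B | 0] S [B | 0]ᵗ = B A B, since A is the Z₁-block of S;
this expression also shows positivity.

The identities need a nonsingular empirical covariance matrix and a nonzero empirical variance.
Almost surely both hold for all large n, because M₀ is invertible and Var(Y) > 0, so the default
values of the estimators do not affect the limit. -/

/-! ### Limit theorems in finite dimension -/

theorem dotProduct_mulVec_secondMoment {Ω : Type*} [MeasurableSpace Ω] {μ : Measure Ω}
    {ι : Type*} [Fintype ι] {U : ι → Ω → ℝ} (hU : ∀ i, MemLp (U i) 2 μ) (t : ι → ℝ) :
    dotProduct t ((Matrix.of fun i j => ∫ ω, U i ω * U j ω ∂μ).mulVec t)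
      = ∫ ω, (∑ i, t i * U i ω) ^ 2 ∂μ := by
  have hint : ∀ i j, Integrable (fun ω => U i ω * U j ω) μ := fun i j =>
    (hU i).integrable_mul (hU j)
  have h1 : ∀ ω, (∑ i, t i * U i ω) ^ 2 = ∑ i, ∑ j, t i * t j * (U i ω * U j ω) := by
    intro ω
    rw [sq, Finset.sum_mul_sum]
    refine Finset.sum_congr rfl fun i _ => Finset.sum_congr rfl fun j _ => by ring
  simp_rw [h1]
  rw [integral_finsetSum _ fun i _ => integrable_finsetSum _ fun j _ => (hint i j).const_mul _]
  simp only [dotProduct, Matrix.mulVec, Matrix.of_apply, Finset.mul_sum]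
  refine Finset.sum_congr rfl fun i _ => ?_
  rw [integral_finsetSum _ fun j _ => (hint i j).const_mul _]
  refine Finset.sum_congr rfl fun j _ => ?_
  rw [integral_const_mul]
  ring

theorem posSemidef_secondMoment {Ω : Type*} [MeasurableSpace Ω] {μ : Measure Ω}
    {ι : Type*} [Fintype ι] {U : ι → Ω → ℝ} (hU : ∀ i, MemLp (U i) 2 μ) :
    (Matrix.of fun i j => ∫ ω, U i ω * U j ω ∂μ).PosSemidef := by
  refine Matrix.PosSemidef.of_dotProduct_mulVec_nonneg ?_ fun t => ?_
  · ext i j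
    simp [mul_comm]
  · rw [star_trivial, dotProduct_mulVec_secondMoment hU]
    exact integral_nonneg fun ω => sq_nonneg _

/-- The **central limit theorem** in `ℝ^ι`, for functions `u a` of independent copies `ξ i` of a
random variable `ξ₀`. -/
theorem tendstoInDistribution_multivariateGaussian {Ω Ω' E ι : Type*} [MeasurableSpace Ω]
    [MeasurableSpace Ω'] [MeasurableSpace E] [Fintype ι] [DecidableEq ι] {μ : Measure Ω}
    [IsProbabilityMeasure μ]
    {P : Measure Ω'} [IsProbabilityMeasure P] {ξ₀ : Ω → E} {ξ : ℕ → Ω' → E}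
    (hindep : iIndepFun ξ P) (hident : ∀ i, IdentDistrib (ξ i) ξ₀ P μ) {u : ι → E → ℝ}
    (hu : ∀ a, Measurable (u a)) (hL2 : ∀ a, MemLp (fun ω => u a (ξ₀ ω)) 2 μ)
    (h0 : ∀ a, ∫ ω, u a (ξ₀ ω) ∂μ = 0) :
    TendstoInDistribution
      (fun (n : ℕ) ω => WithLp.toLp 2 fun a => (√(n : ℝ))⁻¹ * ∑ i ∈ Finset.range n, u a (ξ i ω))
      atTop (id : EuclideanSpace ℝ ι → EuclideanSpace ℝ ι) (fun _ => P)
      (multivariateGaussian 0 (Matrix.of fun a b => ∫ ω, u a (ξ₀ ω) * u b (ξ₀ ω) ∂μ)) := by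
  have hξ : ∀ i, AEMeasurable (ξ i) P := fun i => (hident i).aemeasurable_fst
  have hmeas : ∀ n : ℕ, AEMeasurable (fun ω => WithLp.toLp 2 fun a =>
      (√(n : ℝ))⁻¹ * ∑ i ∈ Finset.range n, u a (ξ i ω)) P := by
    intro n
    refine (WithLp.measurable_toLp 2 _).comp_aemeasurable (aemeasurable_pi_lambda _ fun a => ?_)
    exact (Finset.aemeasurable_fun_sum _ fun i _ =>
      (hu a).comp_aemeasurable (hξ i)).const_mul _
  refine ⟨hmeas, aemeasurable_id, ?_⟩
  refine ProbabilityMeasure.tendsto_iff_tendsto_charFun.2 fun t => ?_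
  -- Cramér–Wold: the characteristic function at `t` is that of the scalar sum of `f` at `1`, so the
  -- one-dimensional theorem suffices.
  let f : E → ℝ := fun e => ∑ a, t a * u a e
  have hf : Measurable f := by fun_prop
  have hidf : ∀ i, IdentDistrib (fun ω => f (ξ i ω)) (fun ω => f (ξ₀ ω)) P μ :=
    fun i => (hident i).comp hf
  have hf2 : MemLp (fun ω => f (ξ₀ ω)) 2 μ :=
    memLp_finsetSum _ fun a _ => (hL2 a).const_mul _
  have hf0 : ∫ ω, f (ξ₀ ω) ∂μ = 0 := by
    simp only [f]
    rw [integral_finsetSum _ fun a _ => ((hL2 a).integrable one_le_two).const_mul _]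
    simp [integral_const_mul, h0]
  have hf0' : ∫ ω, f (ξ 0 ω) ∂P = 0 := (hidf 0).integral_eq.trans hf0
  have hvar : Var[fun ω => f (ξ 0 ω); P]
      = dotProduct t ((Matrix.of fun a b => ∫ ω, u a (ξ₀ ω) * u b (ξ₀ ω) ∂μ).mulVec t) := by
    rw [(hidf 0).variance_eq, variance_eq_integral hf2.1.aemeasurable, hf0,
      dotProduct_mulVec_secondMoment hL2]
    simp [f]
  have hclt := tendstoInDistribution_inv_sqrt_mul_sum_sub (P := P)
    (P' := gaussianReal 0 Var[fun ω => f (ξ 0 ω); P].toNNReal) (X := fun i ω => f (ξ i ω))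
    (Y := id) HasLaw.id ((hidf 0).memLp_iff.2 hf2) (hindep.comp (fun _ => f) fun _ => hf)
    (fun i => (hidf i).trans (hidf 0).symm)
  have h1 := ProbabilityMeasure.tendsto_iff_tendsto_charFun.1 hclt.tendsto 1
  convert! h1 using 2 with n
  · simp only [ProbabilityMeasure.coe_mk, charFun_apply]
    rw [integral_map (hmeas n) (by fun_prop),
      integral_map (hclt.forall_aemeasurable n) (by fun_prop)]
    refine integral_congr_ae (Eventually.of_forall fun ω => ?_)
    simp only [f, PiLp.inner_apply, hf0', mul_zero, sub_zero]
    congr 3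
    simp only [RCLike.inner_apply, conj_trivial, one_mul]
    rw [Finset.sum_comm, Finset.mul_sum]
    refine Finset.sum_congr rfl fun a _ => ?_
    rw [← Finset.mul_sum]
    ring
  · simp only [ProbabilityMeasure.coe_mk, Measure.map_id]
    rw [charFun_multivariateGaussian (posSemidef_secondMoment hL2), charFun_gaussianReal,
      Real.coe_toNNReal _ (variance_nonneg _ _), hvar]
    simp

/-- Compare characteristic functions: that of the image at `t` is the original one at `Gᵀ t`. -/
theorem map_multivariateGaussian_mulVec {ι κ : Type*} [Fintype ι] [DecidableEq ι] [Fintype κ]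
    [DecidableEq κ] {S : Matrix ι ι ℝ} (hS : S.PosSemidef) (G : Matrix κ ι ℝ) :
    (multivariateGaussian 0 S).map
        (fun z : EuclideanSpace ℝ ι => (WithLp.toLp 2 (G.mulVec z.ofLp) : EuclideanSpace ℝ κ))
      = multivariateGaussian 0 (G * S * G.transpose) := by
  have hm : Measurable fun z : EuclideanSpace ℝ ι =>
      (WithLp.toLp 2 (G.mulVec z.ofLp) : EuclideanSpace ℝ κ) := by
    refine Continuous.measurable ?_
    fun_prop
  have := Measure.isProbabilityMeasure_map (μ := multivariateGaussian 0 S) hm.aemeasurable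
  have hS' : (G * S * G.transpose).PosSemidef := by
    simpa using hS.mul_mul_conjTranspose_same G
  refine Measure.ext_of_charFun (funext fun t => ?_)
  rw [charFun_multivariateGaussian hS', charFun_apply, integral_map hm.aemeasurable (by fun_prop)]
  have h := charFun_multivariateGaussian (μ := 0) hS (WithLp.toLp 2 (G.transpose.mulVec t.ofLp))
  rw [charFun_apply] at h
  convert! h using 4 with z
  · congr 2
    simp only [EuclideanSpace.inner_eq_star_dotProduct, star_trivial]
    rw [Matrix.dotProduct_mulVec, Matrix.mulVec_transpose]
  · simp
  · rw [← Matrix.mulVec_mulVec, ← Matrix.mulVec_mulVec, Matrix.dotProduct_mulVec,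
      Matrix.mulVec_transpose]

/-- Slutsky's theorem for the product of a random matrix that converges almost surely and of a
random vector with Gaussian limit. -/
theorem tendstoInDistribution_mulVec {Ω' ι κ : Type*} [MeasurableSpace Ω'] [Fintype ι]
    [DecidableEq ι] [Fintype κ] [DecidableEq κ] {P : Measure Ω'} [IsProbabilityMeasure P]
    {Z : ℕ → Ω' → EuclideanSpace ℝ ι} {S : Matrix ι ι ℝ} (hS : S.PosSemidef)
    (hZ : TendstoInDistribution Z atTop (id : EuclideanSpace ℝ ι → EuclideanSpace ℝ ι)
      (fun _ => P) (multivariateGaussian 0 S))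
    {G : ℕ → Ω' → κ → ι → ℝ} {G₀ : Matrix κ ι ℝ} (hGm : ∀ n, AEMeasurable (G n) P)
    (hG : ∀ᵐ ω ∂P, Tendsto (fun n => G n ω) atTop (𝓝 fun k i => G₀ k i))
    {T : ℕ → Ω' → EuclideanSpace ℝ κ} (hTm : ∀ n, AEMeasurable (T n) P)
    (hT : ∀ᵐ ω ∂P, ∀ᶠ n in atTop,
      T n ω = WithLp.toLp 2 ((Matrix.of (G n ω)).mulVec (Z n ω).ofLp)) :
    TendstoInDistribution T atTop (id : EuclideanSpace ℝ κ → EuclideanSpace ℝ κ)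
      (fun _ => P) (multivariateGaussian 0 (G₀ * S * G₀.transpose)) := by
  let g : EuclideanSpace ℝ ι × (κ → ι → ℝ) → EuclideanSpace ℝ κ :=
    fun q => WithLp.toLp 2 fun k => ∑ i, q.2 k i * q.1 i
  have hg : Continuous g := by fun_prop
  have hGp : TendstoInMeasure P G atTop fun _ => fun k i => G₀ k i :=
    tendstoInMeasure_of_tendsto_ae (fun n => (hGm n).aestronglyMeasurable) hG
  have h1 := hZ.continuous_comp_prodMk_of_tendstoInMeasure_const hg hGp hGm
  have h2 : TendstoInDistribution T atTop
      (fun z : EuclideanSpace ℝ ι => g (id z, fun k i => G₀ k i))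
      (fun _ => P) (multivariateGaussian 0 S) := by
    -- Almost surely `T n` and the product coincide for large `n`, so their difference tends to 0 in
    -- measure and the two have the same limit law.
    refine tendstoInDistribution_of_tendstoInMeasure_sub _ _ h1 ?_ hTm
    refine tendstoInMeasure_of_tendsto_ae (fun n =>
      ((hTm n).sub (h1.forall_aemeasurable n)).aestronglyMeasurable) ?_
    filter_upwards [hT] with ω hω
    refine tendsto_const_nhds.congr' ?_
    filter_upwards [hω] with n hn
    simp only [Pi.sub_apply, Pi.zero_apply, hn]
    exact (sub_self _).symm
  refine ⟨hTm, aemeasurable_id, ?_⟩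
  convert! h2.tendsto using 2
  refine congrArg 𝓝 (Subtype.ext ?_)
  simp only [Measure.map_id]
  exact (map_multivariateGaussian_mulVec hS G₀).symm

/-- The **strong law of large numbers** for a function of independent copies `ξ i` of `ξ₀`. -/
theorem tendsto_mean_ae {Ω Ω' E : Type*} [MeasurableSpace Ω]
    [MeasurableSpace Ω'] [MeasurableSpace E] {μ : Measure Ω}
    {P : Measure Ω'} {ξ₀ : Ω → E} {ξ : ℕ → Ω' → E}
    (hindep : iIndepFun ξ P) (hident : ∀ i, IdentDistrib (ξ i) ξ₀ P μ) {u : E → ℝ}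
    (hu : Measurable u) (hint : Integrable (fun ω => u (ξ₀ ω)) μ) :
    ∀ᵐ ω ∂P, Tendsto (fun n : ℕ => mean fun i : Fin n => u (ξ i ω)) atTop
      (𝓝 (∫ ω, u (ξ₀ ω) ∂μ)) := by
  have hid : ∀ i, IdentDistrib (fun ω => u (ξ i ω)) (fun ω => u (ξ₀ ω)) P μ :=
    fun i => (hident i).comp hu
  have h := strong_law_ae_real (μ := P) (fun i ω => u (ξ i ω)) ((hid 0).integrable_iff.2 hint)
    (fun i j hij => (hindep.indepFun hij).comp hu hu) (fun i => (hid i).trans (hid 0).symm)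
  rw [(hid 0).integral_eq] at h
  filter_upwards [h] with ω hω
  refine hω.congr fun n => ?_
  rw [mean, Finset.sum_range fun i => u (ξ i ω)]

/-! ### Exact formulas for the estimation errors -/

/-- The empirical covariance matrix. -/
noncomputable def empCov {n p : ℕ} (x : Fin n → Fin p → ℝ) : Matrix (Fin p) (Fin p) ℝ :=
  Matrix.of fun j k => (mean fun i => x i j * x i k) - (mean fun i => x i j) * mean fun i => x i k

theorem mean_sub {n : ℕ} (a b : Fin n → ℝ) : (mean fun i => a i - b i) = mean a - mean b := by
  simp [mean, Finset.sum_sub_distrib, sub_div]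

theorem mean_const_mul {n : ℕ} (c : ℝ) (a : Fin n → ℝ) : (mean fun i => c * a i) = c * mean a := by
  simp [mean, ← Finset.mul_sum, mul_div_assoc]

theorem mean_const {n : ℕ} (hn : n ≠ 0) (c : ℝ) : (mean fun _ : Fin n => c) = c := by
  have : (n : ℝ) ≠ 0 := by exact_mod_cast hn
  simp [mean, this]

theorem mean_sum {n p : ℕ} (a : Fin p → Fin n → ℝ) :
    (mean fun i => ∑ k, a k i) = ∑ k, mean (a k) := by
  simp only [mean]
  rw [Finset.sum_comm, Finset.sum_div]

theorem sum_eq_mul_mean {n : ℕ} (hn : n ≠ 0) (a : Fin n → ℝ) : ∑ i, a i = n * mean a := by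
  have : (n : ℝ) ≠ 0 := by exact_mod_cast hn
  rw [mean]
  field_simp

/-- Translation invariance of the empirical covariance; it allows centring at population means
instead of empirical ones. -/
theorem mean_sub_mul_sub {n : ℕ} (hn : n ≠ 0) (a b : Fin n → ℝ) (c d : ℝ) :
    (mean fun i => (a i - c) * (b i - d)) - (mean fun i => a i - c) * (mean fun i => b i - d)
      = (mean fun i => a i * b i) - mean a * mean b := by
  have h1 : ∀ i, (a i - c) * (b i - d) = (a i * b i - d * a i) - (c * b i - c * d) := fun i => by ring
  simp_rw [h1, mean_sub, mean_const_mul, mean_const hn]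
  ring

theorem empCov_mulVec {n p : ℕ} (x : Fin n → Fin p → ℝ) (v : Fin p → ℝ) (j : Fin p) :
    (empCov x).mulVec v j = (mean fun i => x i j * ∑ k, v k * x i k)
      - (mean fun i => x i j) * mean fun i => ∑ k, v k * x i k := by
  have h1 : ∀ i, x i j * ∑ k, v k * x i k = ∑ k, v k * (x i j * x i k) := fun i => by
    rw [Finset.mul_sum]
    exact Finset.sum_congr rfl fun k _ => by ring
  simp_rw [h1, mean_sum, mean_const_mul]
  rw [Finset.mul_sum, ← Finset.sum_sub_distrib]
  simp only [empCov, Matrix.mulVec, dotProduct, Matrix.of_apply]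
  exact Finset.sum_congr rfl fun k _ => by ring

theorem design_mulVec {n p : ℕ} (x : Fin n → Fin p → ℝ) (v : Fin (p + 1) → ℝ) (i : Fin n) :
    (design x).mulVec v i = v 0 + ∑ k : Fin p, v k.succ * x i k := by
  simp [design, Matrix.mulVec, dotProduct, Fin.sum_univ_succ, mul_comm]

/-- A kernel vector of the Gram matrix is killed by the design matrix itself. Its slopes then give a
combination of regressors that is constant on the sample, hence has zero empirical covariance with
every regressor. -/
theorem isUnit_det_design {n p : ℕ} (hn : n ≠ 0) {x : Fin n → Fin p → ℝ}
    (hx : (empCov x).det ≠ 0) : IsUnit ((design x).transpose * design x).det := by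
  rw [isUnit_iff_ne_zero]
  intro hdet
  obtain ⟨v, hv0, hv⟩ := Matrix.exists_mulVec_eq_zero_iff.2 hdet
  apply hv0
  have h0 : (design x).mulVec v = 0 := by
    rw [← Matrix.mulVec_mulVec] at hv
    have h := congrArg (dotProduct v) hv
    rw [dotProduct_zero, Matrix.dotProduct_mulVec, Matrix.vecMul_transpose] at h
    exact dotProduct_self_eq_zero.1 h
  have h1 : ∀ i, ∑ k : Fin p, v k.succ * x i k = -v 0 := fun i => by
    have h := congrFun h0 i
    rw [design_mulVec, Pi.zero_apply] at h
    linarith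
  have h2 : (empCov x).mulVec (fun k => v k.succ) = 0 := by
    funext j
    rw [empCov_mulVec]
    simp_rw [h1, mul_comm _ (-v 0), mean_const_mul, mean_const hn]
    simp [mul_comm]
  have h3 : (fun k : Fin p => v k.succ) = 0 := by
    by_contra hne
    exact hx (Matrix.exists_mulVec_eq_zero_iff.1 ⟨_, hne, h2⟩)
  -- With zero slopes, any single row forces the intercept to vanish; `n ≠ 0` provides one.
  have h4 : v 0 = 0 := by
    have h := h1 ⟨0, Nat.pos_of_ne_zero hn⟩
    have h5 : ∀ k : Fin p, v k.succ = 0 := fun k => congrFun h3 k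
    simp [h5] at h
    exact h
  funext j
  refine Fin.cases h4 (fun k => congrFun h3 k) j

/-- The error of the least squares slopes in terms of the residuals of an arbitrary affine
predictor. -/
theorem alphaHat_sub {n p : ℕ} (hn : n ≠ 0) {y : Fin n → ℝ} {x : Fin n → Fin p → ℝ}
    (hx : (empCov x).det ≠ 0) (b₀ : ℝ) (b m : Fin p → ℝ) {r : Fin n → ℝ}
    (hr : ∀ i, r i = y i - b₀ - ∑ k, b k * x i k) :
    alphaHat y x - b = (empCov x)⁻¹.mulVec fun j =>
      (mean fun i => (x i j - m j) * r i) - (mean fun i => x i j - m j) * mean r := by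
  have hU := isUnit_det_design hn hx
  have hC : IsUnit (empCov x).det := isUnit_iff_ne_zero.2 hx
  set β := olsCoeff y x with hβ
  -- The normal equations: row 0 says that the fitted residuals have mean zero, row `j + 1` that
  -- they are orthogonal to the regressor `j`.
  have hnormal : (design x).transpose.mulVec (y - (design x).mulVec β) = 0 := by
    rw [Matrix.mulVec_sub, Matrix.mulVec_mulVec, hβ, olsCoeff, Matrix.mulVec_mulVec,
      Matrix.mul_nonsing_inv _ hU, Matrix.one_mulVec, sub_self]
  set v : Fin p → ℝ := alphaHat y x - b with hv
  have hres : ∀ i, (y - (design x).mulVec β) i = r i - (β 0 - b₀) - ∑ k, v k * x i k := by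
    intro i
    rw [Pi.sub_apply, design_mulVec, hr]
    simp only [hv, Pi.sub_apply, alphaHat, ← hβ, sub_mul, Finset.sum_sub_distrib]
    ring
  have e0 : (mean fun i => r i - (β 0 - b₀) - ∑ k, v k * x i k) = 0 := by
    have h := congrFun hnormal 0
    simp only [Matrix.mulVec, dotProduct, Matrix.transpose_apply, design, Matrix.of_apply,
      Fin.cons_zero, one_mul, Pi.zero_apply] at h
    simp only [mean]
    rw [← Finset.sum_congr rfl fun i _ => hres i]
    simp only [design]
    rw [h, zero_div]
  have ej : ∀ j : Fin p, (mean fun i => x i j * (r i - (β 0 - b₀) - ∑ k, v k * x i k)) = 0 := by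
    intro j
    have h := congrFun hnormal j.succ
    simp only [mean]
    rw [← Finset.sum_congr rfl fun i _ => congrArg (x i j * ·) (hres i)]
    have h2 : ∑ i, x i j * (y - (design x).mulVec β) i = 0 := by
      rw [Pi.zero_apply] at h
      rw [← h]
      rfl
    rw [h2, zero_div]
  have hmain : (empCov x).mulVec v = fun j =>
      (mean fun i => (x i j - m j) * r i) - (mean fun i => x i j - m j) * mean r := by
    funext j
    have h1 := mean_sub_mul_sub hn (fun i => x i j) r (m j) 0
    simp only [sub_zero] at h1
    rw [h1, empCov_mulVec]
    have h2 := ej j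
    simp only [mul_sub, mean_sub] at h2
    rw [mean_sub, mean_sub, mean_const hn] at e0
    have h3 : (mean fun i => x i j * β 0) - (mean fun i => x i j * b₀)
        = (mean fun i => x i j) * (β 0 - b₀) := by
      simp_rw [mul_comm _ (β 0), mul_comm _ b₀, mean_const_mul]
      ring
    -- Row 0 eliminates the intercept error, leaving a linear system for the slope error `v` with
    -- matrix `empCov x`.
    have e1 : mean r = (β 0 - b₀) + mean fun i => ∑ k, v k * x i k := by
      have : (mean fun i => r i) = mean r := rfl
      linarith
    rw [e1]
    linear_combination (-1 : ℝ) * h2 - h3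
  rw [← hmain, Matrix.mulVec_mulVec, Matrix.nonsing_inv_mul _ hC, Matrix.one_mulVec]

/-- The empirical variance. -/
noncomputable def empVar {n : ℕ} (y : Fin n → ℝ) : ℝ := (mean fun i => y i * y i) - mean y * mean y

/-- The empirical covariance of `y` with `r` is that of `y` with the regressor `k`, minus `th` times
the empirical variance of `y`; divide by that variance. -/
theorem thetaHat_sub {n p : ℕ} (hn : n ≠ 0) {y : Fin n → ℝ} {x : Fin n → Fin p → ℝ}
    (hy : empVar y ≠ 0) (c th m : ℝ) (k : Fin p) {r : Fin n → ℝ}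
    (hr : ∀ i, r i = x i k - c - th * y i) :
    thetaHat y x k - th = (empVar y)⁻¹ *
      ((mean fun i => (y i - m) * r i) - (mean fun i => y i - m) * mean r) := by
  have hn' : (n : ℝ) ≠ 0 := by exact_mod_cast hn
  have hz : ∀ a : Fin n → ℝ, (mean fun i => a i - mean a) = 0 := fun a => by
    rw [mean_sub, mean_const hn]
    exact sub_self _
  have h1 := mean_sub_mul_sub hn y (fun i => x i k) (mean y) (mean fun l => x l k)
  have h2 := mean_sub_mul_sub hn y y (mean y) (mean y)
  rw [hz, zero_mul, sub_zero] at h1 h2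
  have h3 := mean_sub_mul_sub hn y r m 0
  simp only [sub_zero] at h3
  have h3' : (mean fun i => (y i - m) * r i) - (mean fun i => y i - m) * mean r
      = (mean fun i => y i * r i) - mean y * mean r := h3
  have hr' : r = fun i => x i k - c - th * y i := funext hr
  have h4 : (mean fun i => y i * r i) - mean y * mean r
      = ((mean fun i => y i * x i k) - mean y * mean fun i => x i k) - th * empVar y := by
    have h5 : ∀ i, y i * r i = (y i * x i k - c * y i) - th * (y i * y i) := fun i => by
      rw [hr]
      ring
    simp_rw [h5, hr', mean_sub, mean_const_mul, mean_const hn, empVar]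
    have : (mean fun i => y i) = mean y := rfl
    rw [this]
    ring
  rw [h3', h4, thetaHat, sum_eq_mul_mean hn, sum_eq_mul_mean hn, h1]
  simp_rw [sq, h2]
  change _ / ((n : ℝ) * empVar y) - th = _
  field_simp

/-! ### Orthogonality and the population coefficients -/

section Population

variable {Ω : Type*} [MeasurableSpace Ω] {μ : Measure Ω}

theorem memLp_resid [IsFiniteMeasure μ] {k : ℕ} {Z : Fin k → Ω → ℝ} (hZ : ∀ j, MemLp (Z j) 2 μ)
    {T : Ω → ℝ} (hT : MemLp T 2 μ) : MemLp (resid hZ hT) 2 μ :=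
  hT.sub (Lp.memLp _)

theorem integral_resid_mul_withConst [IsFiniteMeasure μ] {k : ℕ} {Z : Fin k → Ω → ℝ}
    (hZ : ∀ j, MemLp (Z j) 2 μ) {T : Ω → ℝ} (hT : MemLp T 2 μ) (j : Fin (k + 1)) :
    ∫ ω, resid hZ hT ω * withConst Z j ω ∂μ = 0 := by
  have h := Submodule.starProjection_inner_eq_zero (K := affSpan hZ) (hT.toLp T)
    ((memLp_withConst hZ j).toLp (withConst Z j)) (Submodule.subset_span ⟨j, rfl⟩)
  rw [L2.inner_def] at h
  rw [← h]
  refine integral_congr_ae ?_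
  filter_upwards [Lp.coeFn_sub (hT.toLp T) ((affSpan hZ).starProjection (hT.toLp T)),
    hT.coeFn_toLp, (memLp_withConst hZ j).coeFn_toLp] with ω h1 h2 h3
  rw [h1, Pi.sub_apply, h2, h3]
  simp [resid, proj, mul_comm]

theorem integral_resid [IsFiniteMeasure μ] {k : ℕ} {Z : Fin k → Ω → ℝ}
    (hZ : ∀ j, MemLp (Z j) 2 μ) {T : Ω → ℝ} (hT : MemLp T 2 μ) :
    ∫ ω, resid hZ hT ω ∂μ = 0 := by
  simpa [withConst] using integral_resid_mul_withConst hZ hT 0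

/-- The centring `m` is free because the residual is orthogonal to constants as well as to each
regressor. -/
theorem integral_sub_mul_resid [IsFiniteMeasure μ] {k : ℕ} {Z : Fin k → Ω → ℝ}
    (hZ : ∀ j, MemLp (Z j) 2 μ) {T : Ω → ℝ} (hT : MemLp T 2 μ) (j : Fin k) (m : ℝ) :
    ∫ ω, (Z j ω - m) * resid hZ hT ω ∂μ = 0 := by
  have h1 : ∫ ω, resid hZ hT ω * Z j ω ∂μ = 0 := by
    simpa [withConst] using integral_resid_mul_withConst hZ hT j.succ
  have h2 : ∀ ω, (Z j ω - m) * resid hZ hT ω = resid hZ hT ω * Z j ω - m * resid hZ hT ω :=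
    fun ω => by ring
  simp_rw [h2]
  have h3 : Integrable (fun ω => resid hZ hT ω * Z j ω) μ :=
    (memLp_resid hZ hT).integrable_mul (hZ j)
  rw [integral_sub h3
    (((memLp_resid hZ hT).integrable one_le_two).const_mul m), h1, integral_const_mul,
    integral_resid]
  simp

theorem eps_ae_eq [IsFiniteMeasure μ] {p : ℕ} {Y : Ω → ℝ} {X : Fin p → Ω → ℝ} (hY : MemLp Y 2 μ)
    (hX : ∀ j, MemLp (X j) 2 μ) :
    eps hY hX =ᵐ[μ] fun ω => Y ω - coeff hX hY 0 - ∑ k, alpha hY hX k * X k ω := by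
  filter_upwards [Classical.choose_spec (exists_coeff hX hY)] with ω hω
  rw [eps, resid, hω, Fin.sum_univ_succ]
  simp [withConst, alpha, coeff, sub_sub]

/-- The residual is uncorrelated with `Y`, which forces the slope to be Cov/Var. The intercept stays
unspecified, since the error formula holds for any intercept. -/
theorem eres_ae_eq [IsProbabilityMeasure μ] {p : ℕ} {Y : Ω → ℝ} {X : Fin p → Ω → ℝ}
    (hY : MemLp Y 2 μ) (hX : ∀ j, MemLp (X j) 2 μ) (hVar : 0 < Var[Y; μ]) (k : Fin p) :
    ∃ c, eres hY hX k =ᵐ[μ] fun ω => X k ω - c - theta μ Y X k * Y ω := by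
  obtain ⟨a, ha⟩ := exists_coeff (Z := fun _ : Fin 1 => Y) (fun _ => hY) (hX k)
  have h1 : eres hY hX k =ᵐ[μ] fun ω => X k ω - (a 0 + a 1 * Y ω) := by
    filter_upwards [ha] with ω hω
    rw [eres, resid, hω]
    simp [withConst]
  have h2 : cov[Y, eres hY hX k; μ] = 0 := by
    rw [covariance, show ∫ ω, eres hY hX k ω ∂μ = 0 from integral_resid _ _]
    simp_rw [sub_zero]
    exact integral_sub_mul_resid (Z := fun _ : Fin 1 => Y) (fun _ => hY) (hX k) 0 _
  have h3 : cov[Y, eres hY hX k; μ] = cov[Y, X k; μ] - a 1 * Var[Y; μ] := by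
    have h4 : cov[Y, eres hY hX k; μ] = cov[Y, fun ω => X k ω - (a 0 + a 1 * Y ω); μ] := by
      refine integral_congr_ae ?_
      rw [integral_congr_ae h1]
      filter_upwards [h1] with ω hω
      rw [hω]
    have h6 : MemLp (fun ω => a 1 * Y ω) 2 μ := hY.const_mul (a 1)
    have h7 : MemLp (fun ω => a 0 + a 1 * Y ω) 2 μ := (memLp_const (a 0)).add h6
    rw [h4, covariance_fun_sub_right hY (hX k) h7,
      covariance_const_add_right (h6.integrable one_le_two),
      covariance_const_mul_right, covariance_self hY.1.aemeasurable]
  have h5 : a 1 = theta μ Y X k := by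
    rw [theta, eq_div_iff hVar.ne']
    linarith
  refine ⟨a 0, ?_⟩
  filter_upwards [h1] with ω hω
  rw [hω, ← h5]
  ring

/-- A kernel vector gives a combination of the centred regressors with zero second moment, hence an
almost sure affine relation. -/
theorem det_covMatrix_ne_zero [IsProbabilityMeasure μ] {p : ℕ} {X : Fin p → Ω → ℝ}
    (hX : ∀ j, MemLp (X j) 2 μ) (hLI : LinIndepWithConst μ X) : (covMatrix μ X).det ≠ 0 := by
  intro hdet
  obtain ⟨v, hv0, hv⟩ := Matrix.exists_mulVec_eq_zero_iff.2 hdet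
  apply hv0
  have hc : ∀ j, MemLp (fun ω => X j ω - μ[X j]) 2 μ := fun j => (hX j).sub (memLp_const _)
  have h1 := dotProduct_mulVec_secondMoment hc v
  rw [show (Matrix.of fun i j => ∫ ω, (X i ω - μ[X i]) * (X j ω - μ[X j]) ∂μ) = covMatrix μ X
    from rfl, hv, dotProduct_zero] at h1
  have hL : MemLp (fun ω => ∑ i, v i * (X i ω - μ[X i])) 2 μ :=
    memLp_finsetSum _ fun j _ => (hc j).const_mul _
  have h2 := (integral_eq_zero_iff_of_nonneg (fun ω => sq_nonneg _) hL.integrable_sq).1 h1.symm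
  -- The intercept undoes the centring.
  have h3 := hLI (Fin.cons (-∑ i, v i * μ[X i]) v) <| by
    filter_upwards [h2] with ω hω
    have h4 : ∑ i, v i * (X i ω - μ[X i]) = 0 := by simpa using hω
    rw [Fin.sum_univ_succ]
    simp only [mul_sub, Finset.sum_sub_distrib] at h4
    simp only [withConst, Fin.cons_zero, Fin.cons_succ]
    linarith
  funext j
  simpa using congrFun h3 j.succ

end Population

/-! ### The joint linear form of the error -/

/-- The centred regressors, as functions of a data point `(y, x)`. -/
def centredRegressor {p : ℕ} (mY : ℝ) (mX : Fin p → ℝ) : Fin p ⊕ Fin p → ℝ × (Fin p → ℝ) → ℝ :=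
  Sum.elim (fun j q => q.2 j - mX j) fun _ q => q.1 - mY

/-- The residuals of affine predictors, as functions of a data point `(y, x)`. -/
def affineResidual {p : ℕ} (b₀ : ℝ) (b c th : Fin p → ℝ) :
    Fin p ⊕ Fin p → ℝ × (Fin p → ℝ) → ℝ :=
  Sum.elim (fun _ q => q.1 - b₀ - ∑ k, b k * q.2 k) fun k q => q.2 k - c k - th k * q.1

@[fun_prop]
theorem measurable_centredRegressor {p : ℕ} (mY : ℝ) (mX : Fin p → ℝ) (a : Fin p ⊕ Fin p) :
    Measurable (centredRegressor mY mX a) := by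
  rcases a with j | k <;> simp only [centredRegressor, Sum.elim_inl, Sum.elim_inr] <;> fun_prop

@[fun_prop]
theorem measurable_affineResidual {p : ℕ} (b₀ : ℝ) (b c th : Fin p → ℝ) (a : Fin p ⊕ Fin p) :
    Measurable (affineResidual b₀ b c th a) := by
  rcases a with j | k <;> simp only [affineResidual, Sum.elim_inl, Sum.elim_inr] <;> fun_prop

/-- The empirical counterpart of `matB`. -/
noncomputable def empB {n p : ℕ} (y : Fin n → ℝ) (x : Fin n → Fin p → ℝ) :
    Matrix (Fin p ⊕ Fin p) (Fin p ⊕ Fin p) ℝ :=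
  Matrix.fromBlocks (empCov x)⁻¹ 0 0 ((empVar y)⁻¹ • 1)

/-- In each product of two means, √n goes to the mean residual, which has a Gaussian limit at that
scale, while the mean regressor is put into the matrix, where it tends to 0. -/
theorem stack_hat_sub {n p : ℕ} (hn : n ≠ 0) {y : Fin n → ℝ} {x : Fin n → Fin p → ℝ}
    (hx : (empCov x).det ≠ 0) (hy : empVar y ≠ 0) (mY b₀ : ℝ) (mX b c th : Fin p → ℝ) :
    √(n : ℝ) • (stack (alphaHat y x) (thetaHat y x) - stack b th)
      = WithLp.toLp 2 ((Matrix.fromCols (empB y x) (-(empB y x * Matrix.diagonal fun a =>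
            mean fun i => centredRegressor mY mX a (y i, x i)))).mulVec
          (Sum.elim
            (fun a => (√(n : ℝ))⁻¹ * ∑ i, centredRegressor mY mX a (y i, x i)
              * affineResidual b₀ b c th a (y i, x i))
            fun a => (√(n : ℝ))⁻¹ * ∑ i, affineResidual b₀ b c th a (y i, x i))) := by
  have hsq : ∀ s : Fin n → ℝ, (√(n : ℝ))⁻¹ * ∑ i, s i = √(n : ℝ) * mean s := fun s => by
    have h0 : (0 : ℝ) < n := by exact_mod_cast Nat.pos_of_ne_zero hn
    have h1 : (n : ℝ) = √(n : ℝ) * √(n : ℝ) := (Real.mul_self_sqrt h0.le).symm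
    have h2 : √(n : ℝ) ≠ 0 := (Real.sqrt_pos.2 h0).ne'
    rw [sum_eq_mul_mean hn]
    nth_rewrite 2 [h1]
    field_simp
  simp_rw [hsq]
  set W := centredRegressor mY mX
  set R := affineResidual b₀ b c th
  rw [stack, stack, ← WithLp.toLp_sub, ← WithLp.toLp_smul]
  congr 1
  rw [Matrix.fromCols_mulVec_sumElim, Matrix.neg_mulVec, ← Matrix.mulVec_mulVec,
    ← sub_eq_add_neg, ← Matrix.mulVec_sub]
  have hvec : ((fun a => √(n : ℝ) * mean fun i => W a (y i, x i) * R a (y i, x i))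
      - (Matrix.diagonal fun a => mean fun i => W a (y i, x i)).mulVec
        fun a => √(n : ℝ) * mean fun i => R a (y i, x i))
      = √(n : ℝ) • fun a => (mean fun i => W a (y i, x i) * R a (y i, x i))
        - (mean fun i => W a (y i, x i)) * mean fun i => R a (y i, x i) := by
    funext a
    simp only [Pi.sub_apply, Matrix.mulVec_diagonal, Pi.smul_apply, smul_eq_mul]
    ring
  rw [hvec, Matrix.mulVec_smul]
  congr 1
  rw [empB, Matrix.fromBlocks_mulVec]
  funext a
  rcases a with j | k
  · simp only [Pi.sub_apply, Sum.elim_inl, Matrix.zero_mulVec, add_zero]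
    exact congrFun (alphaHat_sub hn hx b₀ b mX (r := fun i => y i - b₀ - ∑ k, b k * x i k)
      fun i => rfl) j
  · simp only [Pi.sub_apply, Sum.elim_inr, Matrix.zero_mulVec, zero_add, Matrix.smul_mulVec,
      Matrix.one_mulVec, Pi.smul_apply, smul_eq_mul]
    exact thetaHat_sub hn hy (c k) (th k) mY k (r := fun i => x i k - c k - th k * y i)
      fun i => rfl

/-! ### Measurability of the estimators -/

section Measurability

variable {α : Type*} [MeasurableSpace α]

/-- Inversion is discontinuous at singular matrices, but inverse determinant times adjugate is
measurable everywhere, default value included. -/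
theorem measurable_matrix_inv_apply {ι : Type*} [Fintype ι] [DecidableEq ι] {M : α → Matrix ι ι ℝ}
    (hM : ∀ i j, Measurable fun a => M a i j) (i j : ι) : Measurable fun a => (M a)⁻¹ i j := by
  have hM' : Measurable fun a => (fun i j => M a i j : ι → ι → ℝ) :=
    measurable_pi_lambda _ fun i => measurable_pi_lambda _ fun j => hM i j
  have h1 : Continuous fun N : ι → ι → ℝ => (Matrix.of N).det :=
    Continuous.matrix_det continuous_id
  have h2 : Continuous fun N : ι → ι → ℝ => (Matrix.of N).adjugate i j :=
    (Continuous.matrix_adjugate continuous_id).matrix_elem i j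
  simp_rw [Matrix.inv_def, Ring.inverse_eq_inv', Matrix.smul_apply, smul_eq_mul]
  exact (h1.measurable.comp hM').inv.mul (h2.measurable.comp hM')

theorem measurable_mean {n : ℕ} {f : Fin n → α → ℝ} (hf : ∀ i, Measurable (f i)) :
    Measurable fun a => mean fun i => f i a := by
  unfold mean
  fun_prop

variable {n p : ℕ}

theorem measurable_empB_apply (a b : Fin p ⊕ Fin p) :
    Measurable fun q : Fin n → ℝ × (Fin p → ℝ) =>
      empB (fun i => (q i).1) (fun i => (q i).2) a b := by
  have h1 : ∀ j k, Measurable fun q : Fin n → ℝ × (Fin p → ℝ) => empCov (fun i => (q i).2) j k := by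
    intro j k
    refine Measurable.sub (measurable_mean fun i => ?_)
      (Measurable.mul (measurable_mean fun i => ?_) (measurable_mean fun i => ?_)) <;> fun_prop
  have h2 : Measurable fun q : Fin n → ℝ × (Fin p → ℝ) => empVar fun i => (q i).1 := by
    refine Measurable.sub (measurable_mean fun i => ?_)
      (Measurable.mul (measurable_mean fun i => ?_) (measurable_mean fun i => ?_)) <;> fun_prop
  rcases a with a | a <;> rcases b with b | b
  · exact measurable_matrix_inv_apply h1 a b
  · exact measurable_const
  · exact measurable_const
  · exact h2.inv.mul_const _

theorem measurable_stack_hat :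
    Measurable fun q : Fin n → ℝ × (Fin p → ℝ) =>
      stack (alphaHat (fun i => (q i).1) fun i => (q i).2)
        (thetaHat (fun i => (q i).1) fun i => (q i).2) := by
  refine (WithLp.measurable_toLp 2 _).comp (measurable_pi_lambda _ fun a => ?_)
  have hd : ∀ (i : Fin n) (j : Fin (p + 1)),
      Measurable fun q : Fin n → ℝ × (Fin p → ℝ) => design (fun i => (q i).2) i j := by
    intro i j
    refine Fin.cases ?_ (fun k => ?_) j
    · simp [design]
    · simp only [design, Matrix.of_apply, Fin.cons_succ]
      fun_prop
  rcases a with j | k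
  · simp only [Sum.elim_inl, alphaHat, olsCoeff, Matrix.mulVec, dotProduct]
    refine Finset.measurable_fun_sum _ fun l _ => Measurable.mul
      (measurable_matrix_inv_apply (fun a b => ?_) _ _) ?_
    · simp only [Matrix.mul_apply, Matrix.transpose_apply]
      exact Finset.measurable_fun_sum _ fun i _ => (hd i a).mul (hd i b)
    · simp only [Matrix.transpose_apply]
      exact Finset.measurable_fun_sum _ fun i _ => (hd i l).mul (by fun_prop)
  · simp only [Sum.elim_inr, thetaHat, mean]
    fun_prop

end Measurability

/-! ### Almost sure convergence of the empirical matrices -/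

/-- The strong law for first and second moments, then continuity of the determinant and of inversion
at the invertible limit. -/
theorem tendsto_empB_ae {Ω Ω' : Type*} [MeasurableSpace Ω] [MeasurableSpace Ω'] {μ : Measure Ω}
    [IsProbabilityMeasure μ] {P : Measure Ω'} {p : ℕ} {Y : Ω → ℝ} {X : Fin p → Ω → ℝ}
    (hY : MemLp Y 2 μ) (hX : ∀ j, MemLp (X j) 2 μ) (hVar : 0 < Var[Y; μ])
    (hLI : LinIndepWithConst μ X) {ξ : ℕ → Ω' → ℝ × (Fin p → ℝ)} (hindep : iIndepFun ξ P)
    (hident : ∀ i, IdentDistrib (ξ i) (fun ω => (Y ω, fun j => X j ω)) P μ) :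
    ∀ᵐ ω ∂P,
      (∀ᶠ n in atTop, (empCov fun i : Fin n => (ξ i ω).2).det ≠ 0) ∧
      (∀ᶠ n in atTop, empVar (fun i : Fin n => (ξ i ω).1) ≠ 0) ∧
      Tendsto (fun n => empB (fun i : Fin n => (ξ i ω).1) fun i => (ξ i ω).2) atTop
        (𝓝 (matB μ Y X)) := by
  have hXX : ∀ᵐ ω ∂P, ∀ j k, Tendsto (fun n => mean fun i : Fin n => (ξ i ω).2 j * (ξ i ω).2 k)
      atTop (𝓝 (∫ ω, X j ω * X k ω ∂μ)) := by
    simp_rw [ae_all_iff]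
    exact fun j k => tendsto_mean_ae hindep hident (u := fun q => q.2 j * q.2 k) (by fun_prop)
      ((hX j).integrable_mul (hX k))
  have hX1 : ∀ᵐ ω ∂P, ∀ j, Tendsto (fun n => mean fun i : Fin n => (ξ i ω).2 j)
      atTop (𝓝 (∫ ω, X j ω ∂μ)) := by
    simp_rw [ae_all_iff]
    exact fun j => tendsto_mean_ae hindep hident (u := fun q => q.2 j) (by fun_prop)
      ((hX j).integrable one_le_two)
  have hYY := tendsto_mean_ae hindep hident (u := fun q => q.1 * q.1) (by fun_prop)
    (hY.integrable_mul hY)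
  have hY1 := tendsto_mean_ae hindep hident (u := fun q => q.1) (by fun_prop)
    (hY.integrable one_le_two)
  filter_upwards [hXX, hX1, hYY, hY1] with ω hXX hX1 hYY hY1
  have hC : Tendsto (fun n => empCov fun i : Fin n => (ξ i ω).2) atTop (𝓝 (covMatrix μ X)) := by
    refine tendsto_pi_nhds.2 fun j => tendsto_pi_nhds.2 fun k => ?_
    have h := (hXX j k).sub ((hX1 j).mul (hX1 k))
    rw [show covMatrix μ X j k = cov[X j, X k; μ] from rfl, covariance_eq_sub (hX j) (hX k)]
    exact h
  have hV : Tendsto (fun n => empVar fun i : Fin n => (ξ i ω).1) atTop (𝓝 Var[Y; μ]) := by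
    have h := hYY.sub (hY1.mul hY1)
    rw [← covariance_self hY.1.aemeasurable, covariance_eq_sub hY hY]
    exact h
  have hdet := det_covMatrix_ne_zero hX hLI
  refine ⟨?_, hV.eventually_ne hVar.ne', ?_⟩
  · have hd : Continuous fun M : Matrix (Fin p) (Fin p) ℝ => M.det :=
      Continuous.matrix_det continuous_id
    exact ((hd.tendsto _).comp hC).eventually_ne hdet
  · have hinv : Tendsto (fun n => (empCov fun i : Fin n => (ξ i ω).2)⁻¹) atTop
        (𝓝 (covMatrix μ X)⁻¹) := by
      refine (continuousAt_matrix_inv _ ?_).tendsto.comp hC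
      rw [Ring.inverse_eq_inv']
      exact continuousAt_inv₀ hdet
    have hinv' := hV.inv₀ hVar.ne'
    refine tendsto_pi_nhds.2 fun a => tendsto_pi_nhds.2 fun b => ?_
    rcases a with a | a <;> rcases b with b | b
    · exact (tendsto_pi_nhds.1 (tendsto_pi_nhds.1 hinv a) b)
    · exact tendsto_const_nhds
    · exact tendsto_const_nhds
    · exact hinv'.mul_const _

theorem matB_transpose {Ω : Type*} [MeasurableSpace Ω] (μ : Measure Ω) {p : ℕ} (Y : Ω → ℝ)
    (X : Fin p → Ω → ℝ) : (matB μ Y X).transpose = matB μ Y X := by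
  have h : (covMatrix μ X).transpose = covMatrix μ X := by
    ext i j
    exact covariance_comm _ _
  rw [matB, Matrix.fromBlocks_transpose, Matrix.transpose_nonsing_inv, h]
  simp

end MultipleRegression

/-! ### Assembly -/

theorem proposition3p1
    {Ω : Type*} [MeasurableSpace Ω] (μ : Measure Ω) [IsProbabilityMeasure μ]
    {p : ℕ} (Y : Ω → ℝ) (X : Fin p → Ω → ℝ)
    (hY : MemLp Y 2 μ) (hX : ∀ j, MemLp (X j) 2 μ)
    (hVar : 0 < Var[Y; μ])
    (hLI : LinIndepWithConst μ X)
    (hXeps : ∀ j, Integrable (fun ω => (X j ω - μ[X j]) ^ 2 * eps hY hX ω ^ 2) μ)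
    (hYe : ∀ j, Integrable (fun ω => (Y ω - μ[Y]) ^ 2 * eres hY hX j ω ^ 2) μ)
    {Ω' : Type*} [MeasurableSpace Ω'] (P : Measure Ω') [IsProbabilityMeasure P]
    (Ys : ℕ → Ω' → ℝ) (Xs : ℕ → Fin p → Ω' → ℝ)
    (hindep : iIndepFun (fun (i : ℕ) (ω : Ω') => (Ys i ω, fun j => Xs i j ω)) P)
    (hident : ∀ i : ℕ, IdentDistrib (fun ω : Ω' => (Ys i ω, fun j => Xs i j ω))
      (fun ω : Ω => (Y ω, fun j => X j ω)) P μ) :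
    (matB μ Y X * matA hY hX * matB μ Y X).PosSemidef ∧
    TendstoInDistribution
      (fun (n : ℕ) (ω : Ω') =>
        √(n : ℝ) •
          (stack
              (alphaHat (fun i : Fin n => Ys i ω) (fun (i : Fin n) j => Xs i j ω))
              (thetaHat (fun i : Fin n => Ys i ω) (fun (i : Fin n) j => Xs i j ω))
            - stack (alpha hY hX) (theta μ Y X)))
      atTop (id : EuclideanSpace ℝ (Fin p ⊕ Fin p) → EuclideanSpace ℝ (Fin p ⊕ Fin p))
      (fun _ => P)
      (multivariateGaussian 0 (matB μ Y X * matA hY hX * matB μ Y X)) := by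
  choose c hc using eres_ae_eq hY hX hVar
  set W := centredRegressor μ[Y] (fun j => μ[X j]) with hW
  set R := affineResidual (coeff hX hY 0) (alpha hY hX) c (theta μ Y X)
  set ξ₀ : Ω → ℝ × (Fin p → ℝ) := fun ω => (Y ω, fun j => X j ω) with hξ₀
  set ξ : ℕ → Ω' → ℝ × (Fin p → ℝ) := fun i ω => (Ys i ω, fun j => Xs i j ω)
  -- The population residuals and regressors, in stacked form.
  let ρ : Fin p ⊕ Fin p → Ω → ℝ := Sum.elim (fun _ => eps hY hX) (eres hY hX)
  have hρ2 : ∀ a, MemLp (ρ a) 2 μ := by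
    rintro (j | k)
    · exact memLp_resid _ _
    · exact memLp_resid _ _
  have hρR : ∀ a, (fun ω => R a (ξ₀ ω)) =ᵐ[μ] ρ a := by
    rintro (j | k)
    · exact (eps_ae_eq hY hX).symm
    · exact (hc k).symm
  have hWR : ∀ a, (fun ω => W a (ξ₀ ω) * R a (ξ₀ ω)) =ᵐ[μ] fun ω => W a (ξ₀ ω) * ρ a ω :=
    fun a => (hρR a).mono fun ω h => congrArg (W a (ξ₀ ω) * ·) h
  have hW2 : ∀ a, MemLp (fun ω => W a (ξ₀ ω)) 2 μ := by
    rintro (j | k)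
    · exact (hX j).sub (memLp_const _)
    · exact hY.sub (memLp_const _)
  have hW0 : ∀ a, ∫ ω, W a (ξ₀ ω) ∂μ = 0 := by
    have h : ∀ Z : Ω → ℝ, MemLp Z 2 μ → ∫ ω, (Z ω - μ[Z]) ∂μ = 0 := fun Z hZ => by
      rw [integral_sub (hZ.integrable one_le_two) (integrable_const _)]
      simp
    rintro (j | k)
    · exact h _ (hX j)
    · exact h _ hY
  -- The two fourth-order moment assumptions are exactly this square integrability.
  have hWρ2 : ∀ a, MemLp (fun ω => W a (ξ₀ ω) * ρ a ω) 2 μ := by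
    intro a
    have hm : AEStronglyMeasurable (fun ω => W a (ξ₀ ω) * ρ a ω) μ := (hW2 a).1.mul (hρ2 a).1
    refine (memLp_two_iff_integrable_sq hm).2 ?_
    simp_rw [mul_pow]
    rcases a with j | k
    · exact hXeps j
    · exact hYe k
  have hWρ0 : ∀ a, ∫ ω, W a (ξ₀ ω) * ρ a ω ∂μ = 0 := by
    rintro (j | k)
    · exact integral_sub_mul_resid hX hY j _
    · exact integral_sub_mul_resid (Z := fun _ : Fin 1 => Y) (fun _ => hY) (hX k) 0 _
  have hA : matA hY hX
      = Matrix.of fun a b => ∫ ω, (W a (ξ₀ ω) * ρ a ω) * (W b (ξ₀ ω) * ρ b ω) ∂μ := by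
    ext a b
    rcases a with a | a <;> rcases b with b | b <;>
      refine integral_congr_ae (Eventually.of_forall fun ω => ?_) <;>
      simp only [hW, hξ₀, ρ, centredRegressor, Sum.elim_inl, Sum.elim_inr] <;> ring
  -- The products and the bare residuals enter one central limit theorem, since the error formula
  -- involves both.
  let u : (Fin p ⊕ Fin p) ⊕ (Fin p ⊕ Fin p) → ℝ × (Fin p → ℝ) → ℝ :=
    Sum.elim (fun a q => W a q * R a q) R
  have hWm : ∀ a, Measurable (W a) := fun a => measurable_centredRegressor _ _ a
  have hRm : ∀ a, Measurable (R a) := fun a => measurable_affineResidual _ _ _ _ a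
  have hum : ∀ a, Measurable (u a) := by
    rintro (a | a)
    · exact (hWm a).mul (hRm a)
    · exact hRm a
  have hu2 : ∀ a, MemLp (fun ω => u a (ξ₀ ω)) 2 μ := by
    rintro (a | a)
    · exact (hWρ2 a).ae_eq (hWR a).symm
    · exact (hρ2 a).ae_eq (hρR a).symm
  have hu0 : ∀ a, ∫ ω, u a (ξ₀ ω) ∂μ = 0 := by
    rintro (a | a)
    · exact (integral_congr_ae (hWR a)).trans (hWρ0 a)
    · refine (integral_congr_ae (hρR a)).trans ?_
      rcases a with j | k <;> exact integral_resid _ _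
  set S := Matrix.of fun a b => ∫ ω, u a (ξ₀ ω) * u b (ξ₀ ω) ∂μ
  have hSA : S.toBlocks₁₁ = matA hY hX := by
    rw [hA]
    ext a b
    refine integral_congr_ae ?_
    filter_upwards [hWR a, hWR b] with ω h1 h2
    exact congrArg₂ (· * ·) h1 h2
  -- The zero block is the limit of the part carrying the empirical means of `W`; it erases every
  -- block of `S` except that of the products.
  let G₀ : Matrix (Fin p ⊕ Fin p) ((Fin p ⊕ Fin p) ⊕ (Fin p ⊕ Fin p)) ℝ :=
    Matrix.fromCols (matB μ Y X) 0
  have hcov : G₀ * S * G₀.transpose = matB μ Y X * matA hY hX * matB μ Y X := by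
    simp only [G₀]
    rw [← Matrix.fromBlocks_toBlocks S, Matrix.fromCols_mul_fromBlocks, Matrix.transpose_fromCols,
      Matrix.fromCols_mul_fromRows, hSA, matB_transpose]
    simp
  have hSpsd : S.PosSemidef := posSemidef_secondMoment hu2
  refine ⟨?_, ?_⟩
  · rw [← hcov]
    simpa using hSpsd.mul_mul_conjTranspose_same G₀
  rw [← hcov]
  have hξm : ∀ i, AEMeasurable (ξ i) P := fun i => (hident i).aemeasurable_fst
  have hdata : ∀ n : ℕ, AEMeasurable (fun ω => fun i : Fin n => ξ i ω) P :=
    fun n => aemeasurable_pi_lambda _ fun i => hξm i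
  have hmeanW : ∀ᵐ ω ∂P, ∀ a, Tendsto (fun n : ℕ => mean fun i : Fin n => W a (ξ i ω)) atTop
      (nhds 0) := by
    rw [ae_all_iff]
    intro a
    have h := tendsto_mean_ae hindep hident (hWm a) ((hW2 a).integrable one_le_two)
    rwa [hW0 a] at h
  have hB := tendsto_empB_ae hY hX hVar hLI hindep hident
  refine tendstoInDistribution_mulVec hSpsd
    (tendstoInDistribution_multivariateGaussian hindep hident hum hu2 hu0)
    (G := fun n ω => Matrix.fromCols
      (empB (fun i : Fin n => (ξ i ω).1) fun i => (ξ i ω).2)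
      (-(empB (fun i : Fin n => (ξ i ω).1) (fun i => (ξ i ω).2) *
        Matrix.diagonal fun a => mean fun i : Fin n => W a (ξ i ω)))) ?_ ?_ ?_ ?_
  · intro n
    refine aemeasurable_pi_lambda _ fun a => aemeasurable_pi_lambda _ fun b => ?_
    rcases b with b | b
    · exact (measurable_empB_apply a b).comp_aemeasurable (hdata n)
    · simp only [Matrix.fromCols_apply_inr, Matrix.neg_apply, Matrix.mul_diagonal]
      refine Measurable.comp_aemeasurable (f := fun ω => fun i : Fin n => ξ i ω)
        (g := fun q : Fin n → ℝ × (Fin p → ℝ) => -(empB (fun i => (q i).1) (fun i => (q i).2) a b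
          * mean fun i => W b (q i))) ?_ (hdata n)
      exact ((measurable_empB_apply a b).mul
        (measurable_mean fun i => (hWm b).comp (measurable_pi_apply i))).neg
  · filter_upwards [hB, hmeanW] with ω hω hm
    refine tendsto_pi_nhds.2 fun a => tendsto_pi_nhds.2 fun b => ?_
    have h := fun b => tendsto_pi_nhds.1 (tendsto_pi_nhds.1 hω.2.2 a) b
    rcases b with b | b
    · exact h b
    · simp only [Matrix.fromCols_apply_inr, Matrix.neg_apply, Matrix.mul_diagonal]
      simpa [G₀] using ((h b).mul (hm b)).neg
  · intro n
    have h := measurable_stack_hat.comp_aemeasurable (hdata n)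
    exact (h.sub_const (stack (alpha hY hX) (theta μ Y X))).const_smul √(n : ℝ)
  · filter_upwards [hB] with ω hω
    filter_upwards [hω.1, hω.2.1, eventually_ne_atTop 0] with n h1 h2 hn
    refine (stack_hat_sub hn h1 h2 μ[Y] (coeff hX hY 0) (fun j => μ[X j]) (alpha hY hX) c
      (theta μ Y X)).trans ?_
    congr 2
    funext a
    rcases a with a | a
    · exact congrArg _ (Finset.sum_range fun i => W a (ξ i ω) * R a (ξ i ω)).symm
    · exact congrArg _ (Finset.sum_range fun i => R a (ξ i ω)).symm
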